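/- Let $\ell\in\mathbb N$ be odd and let $s\ge 0$ be the integer with $3^{s}\,\|\,\ell$, i.e. $3^s\mid \ell$ and $3^{s+1}\nmid \ell$. Then for every integer $k\ge 0$, $$\sum_{d\mid 3k+2}\left(\frac d3\right)d^{2\ell}\equiv 0 \pmod{3^{s+1}},\qquad \sum_{d\mid 3k+1}\left(\frac d3\right)d^{2\ell}\equiv c_3(k)\pmod{3^{s+1}},$$ $$\sum_{d\mid 3k+2}d^{\ell}\equiv 0 \pmod{3^{s+1}},\qquad \sum_{d\mid 3k+1}d^{\ell}\equiv c_3(k)\pmod{3^{s+1}}.$$ Here the sums run over the positive divisors $d$, $\left(\frac{\cdot}{3}\right)$ denotes the Jacobi symbol modulo three, and $c_3(k)$ is the number of $3$-core partitions of $k$, i.e. the number of partitions of $k$ such that no hook number in the Ferrers graph is divisible by $3$. (The hook number of a cell is the number of cells to its right in its row, plus the number of cells below it in its column, plus one.) -/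

import Mathlib

/-- The Ferrers graph (Young diagram) of a partition: its rows, from top to bottom, are the parts
in weakly decreasing order. -/
def Nat.Partition.ferrersGraph {n : ℕ} (p : n.Partition) : YoungDiagram :=
  YoungDiagram.ofRowLens (p.parts.sort (· ≥ ·)) (p.parts.pairwise_sort (· ≥ ·)).sortedGE

/-- The hook number at the cell `c = (i, j)` (row `i`, column `j`, counted from `0`): the number of
cells to the right of `c` in its row, plus the number of cells below `c` in its column, plus one for
`c` itself. It is meant for cells `c` of `μ`, where no truncation occurs. -/
def YoungDiagram.hookNumber (μ : YoungDiagram) (c : ℕ × ℕ) : ℕ :=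
  (μ.rowLen c.1 - (c.2 + 1)) + (μ.colLen c.2 - (c.1 + 1)) + 1

/-- A partition is a `t`-core if no hook number in its Ferrers graph is divisible by `t`. -/
def Nat.Partition.IsCore (t : ℕ) {n : ℕ} (p : n.Partition) : Prop :=
  ∀ c ∈ p.ferrersGraph.cells, ¬ t ∣ p.ferrersGraph.hookNumber c

/-- The number `c_t(n)` of `t`-core partitions of `n`. -/
noncomputable def coreCount (t n : ℕ) : ℕ :=
  Nat.card {p : n.Partition // p.IsCore t}

/-!
For `d` prime to `3` the power `d ^ ℓ` is congruent to `(d / 3)` modulo `3 ^ (s + 1)`: raising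
`d ≡ ±1 [ZMOD 3]` to the power `3 ^ s` lifts the congruence to `3 ^ (s + 1)`, and `ℓ` is an odd
multiple of `3 ^ s`. Likewise `d ^ (2 * ℓ) ≡ 1`. All four claims thus reduce to two exact identities
for `h(N) = ∑_{d ∣ N} (d / 3)`, namely `h(3k + 2) = 0` and `h(3k + 1) = c₃(k)`. Both come from
counting the set `primaryReps N` of Eisenstein integers `x + y ω ≡ 1 (mod 3)` of norm `N`, where
`ω` is a primitive cube root of unity.

* `ncard_primaryReps_eq_sum_jacobiSym`: the count is `h(N)` when `3 ∤ N`. For a prime `p ∣ N`, write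
  `N = p M`. Every element of norm `p M` is divisible by `p` if `p` is inert
  (`ncard_primaryReps_inert`); if `p = π π̄` splits, it is divisible by `π` or by `π̄`
  (`ncard_primaryReps_split`). Inclusion-exclusion gives a recursion in `M` and `M / p`, and `h`
  satisfies the same recursion (`sum_divisors_prime_mul`). Only the existence of a `π` of norm `p` is
  needed, not unique factorization; it follows from Thue's lemma.
* `primaryReps_eq_empty`: a primary element has norm `1` modulo `3`, so the count is `0` at `3k + 2`.
* `coreCount_three_eq_ncard_primaryReps`: the count at `3k + 1` is `c₃(k)`. A partition of `k` is
  encoded by its beta-set with `3k` beads; it is a `3`-core exactly when the beta-set is closed under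
  subtracting `3` (`YoungDiagram.forall_not_dvd_hookNumber_iff`). Such a set is the union of three
  runners of lengths `n₀`, `n₁`, `n₂` with sum `3k`, and prescribing the sum of the beads means that
  `x = 1 + 3 (n₂ - k)`, `y = 3 (k - n₁)` satisfy `x² - x y + y² = 3k + 1`.
-/

/-! ### Primary Eisenstein integers of given norm -/

/-- The primary Eisenstein integers of norm `N`: the pair `(x, y)` stands for `x + y ω`, where
`ω ^ 2 + ω + 1 = 0`, and primary means congruent to `1` modulo `3`. An element of norm prime to `3`
has exactly one primary associate. -/
def primaryReps (N : ℤ) : Set (ℤ × ℤ) :=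
  {z | z.1 ^ 2 - z.1 * z.2 + z.2 ^ 2 = N ∧ 3 ∣ z.1 - 1 ∧ 3 ∣ z.2}

theorem finite_primaryReps (N : ℤ) : (primaryReps N).Finite := by
  refine ((Set.finite_Icc (-2 * |N|) (2 * |N|)).prod (Set.finite_Icc (-2 * |N|) (2 * |N|))).subset ?_
  rintro ⟨x, y⟩ ⟨h, -, -⟩
  simp only at h
  have hN := le_abs_self N
  simp only [Set.mem_prod, Set.mem_Icc]
  refine ⟨⟨?_, ?_⟩, ?_, ?_⟩ <;>
    nlinarith [sq_nonneg (2 * x - y), sq_nonneg (2 * y - x), sq_nonneg (x + 1), sq_nonneg (x - 1),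
      sq_nonneg (y + 1), sq_nonneg (y - 1)]

theorem primaryReps_one : primaryReps 1 = {(1, 0)} := by
  ext ⟨x, y⟩
  simp only [primaryReps, Set.mem_ofPred_eq, Set.mem_singleton_iff, Prod.mk.injEq]
  constructor
  · rintro ⟨h, hx, hy⟩
    have hy0 : y = 0 := by
      have : y < 2 := by nlinarith [sq_nonneg (2 * x - y)]
      have : -2 < y := by nlinarith [sq_nonneg (2 * x - y)]
      omega
    subst hy0
    have : x < 2 := by nlinarith
    have : -2 < x := by nlinarith
    omega
  · rintro ⟨rfl, rfl⟩
    norm_num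

/-- A primary Eisenstein integer has norm congruent to `1` modulo `3`. -/
theorem primaryReps_eq_empty {N : ℤ} (hN : N % 3 = 2) : primaryReps N = ∅ := by
  ext ⟨x, y⟩
  simp only [primaryReps, Set.mem_ofPred_eq, Set.mem_empty_iff_false, iff_false]
  rintro ⟨h, ⟨a, ha⟩, ⟨b, rfl⟩⟩
  obtain rfl : x = 3 * a + 1 := by omega
  have : N = 3 * (3 * a ^ 2 + 2 * a - 3 * a * b - b + 3 * b ^ 2) + 1 := by rw [← h]; ring
  omega

/-- Primes `p ≡ 2 (mod 3)` are inert: `x ^ 3 = (-y) ^ 3` in `ZMod p`, and cubing is injective on the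
units because their number `p - 1` is prime to `3`. -/
theorem dvd_of_dvd_eisenstein_norm {p : ℕ} [Fact p.Prime] (hp : p % 3 = 2) {x y : ℤ}
    (h : (p : ℤ) ∣ x ^ 2 - x * y + y ^ 2) : (p : ℤ) ∣ x ∧ (p : ℤ) ∣ y := by
  simp only [← ZMod.intCast_zmod_eq_zero_iff_dvd] at h ⊢
  push_cast at h
  set a : ZMod p := (x : ZMod p)
  set b : ZMod p := (y : ZMod p)
  have h3 : (3 : ZMod p) ≠ 0 := by
    intro h0
    have : ((3 : ℕ) : ZMod p) = 0 := by exact_mod_cast h0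
    rw [ZMod.natCast_eq_zero_iff] at this
    have := (Nat.prime_dvd_prime_iff_eq (Fact.out : p.Prime) Nat.prime_three).1 this
    omega
  have hb : b = 0 := by
    by_contra hb
    have ha : a ≠ 0 := by
      rintro ha
      rw [ha] at h
      apply hb
      simpa using h
    have hcube : a ^ 3 = (-b) ^ 3 := by linear_combination (a + b) * h
    obtain ⟨k, hk⟩ : ∃ k, p - 1 = 3 * k + 1 := ⟨p / 3, by omega⟩
    have e1 := ZMod.pow_card_sub_one_eq_one ha
    have e2 := ZMod.pow_card_sub_one_eq_one (neg_ne_zero.2 hb)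
    rw [hk, pow_succ, pow_mul] at e1 e2
    have hne : ((-b) ^ 3) ^ k ≠ 0 := pow_ne_zero _ (pow_ne_zero _ (neg_ne_zero.2 hb))
    rw [hcube, ← e2] at e1
    have hab := mul_left_cancel₀ hne e1
    rw [hab] at h
    have : (3 : ZMod p) * b ^ 2 = 0 := by linear_combination h
    simp [h3, hb] at this
  refine ⟨?_, hb⟩
  rw [hb] at h
  simpa using h

/-- Thue's lemma: by the pigeonhole principle, two of the pairs of integers in `[0, √p]` give the same
value of `x - n y`, and their difference is a small solution of `x = n y`. -/
theorem exists_small_mul_eq (p : ℕ) [Fact p.Prime] (n : ZMod p) :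
    ∃ x y : ℤ, (x, y) ≠ (0, 0) ∧ x ^ 2 < p ∧ y ^ 2 < p ∧ (x : ZMod p) = n * y := by
  have hp : p.Prime := Fact.out
  set m := p.sqrt
  have hm : m * m < p := lt_of_le_of_ne (Nat.sqrt_le p) fun h => by
    exact hp.prime.not_isSquare ⟨m, h.symm⟩
  have hm2 : p < (m + 1) * (m + 1) := Nat.lt_succ_sqrt p
  obtain ⟨⟨a, b⟩, hab, ⟨c, d⟩, hcd, hne, heq⟩ :=
    Finset.exists_ne_map_eq_of_card_lt_of_maps_to
      (s := Finset.range (m + 1) ×ˢ Finset.range (m + 1)) (t := (Finset.univ : Finset (ZMod p)))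
      (f := fun z => (z.1 : ZMod p) - n * z.2) (by simpa [ZMod.card] using hm2) (by simp)
  simp only [Finset.mem_product, Finset.mem_range] at hab hcd heq
  have hsq : ∀ u v : ℕ, u < m + 1 → v < m + 1 → ((u : ℤ) - v) ^ 2 < p := by
    intro u v hu hv
    have : (m : ℤ) * m < p := by exact_mod_cast hm
    have h1 : (u : ℤ) - v ≤ m := by omega
    have h2 : -(m : ℤ) ≤ (u : ℤ) - v := by omega
    nlinarith
  refine ⟨a - c, b - d, ?_, hsq _ _ hab.1 hcd.1, hsq _ _ hab.2 hcd.2, ?_⟩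
  · intro h
    apply hne
    simp only [Prod.mk.injEq] at h ⊢
    omega
  · push_cast
    linear_combination heq

/-- For `p ≡ 1 (mod 3)` there is a primitive cube root of unity modulo `p`, and Thue's lemma turns it
into an Eisenstein integer whose norm is a multiple of `p` below `3 p`. -/
theorem exists_eisenstein_norm_eq {p : ℕ} [hp : Fact p.Prime] (h1 : p % 3 = 1) :
    ∃ x y : ℤ, x ^ 2 - x * y + y ^ 2 = p := by
  obtain ⟨n, hn⟩ : ∃ n : ZMod p, n ^ 2 - n + 1 = 0 := by
    have h3 : 3 ∣ Fintype.card (ZMod p)ˣ := by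
      rw [ZMod.card_units]; omega
    have : Fact (Nat.Prime 3) := ⟨Nat.prime_three⟩
    obtain ⟨u, hu⟩ := exists_prime_orderOf_dvd_card 3 h3
    have hu3 : (u : ZMod p) ^ 3 = 1 := by
      have := pow_orderOf_eq_one u
      rw [hu] at this
      rw [← Units.val_pow_eq_pow_val, this, Units.val_one]
    have hu1 : (u : ZMod p) ≠ 1 := by
      intro h
      have : u = 1 := Units.ext h
      simp [this] at hu
    -- `u ^ 3 - 1 = (u - 1) (u ^ 2 + u + 1)` and `u ≠ 1`
    refine ⟨-u, mul_left_cancel₀ (sub_ne_zero.2 hu1) ?_⟩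
    linear_combination hu3
  obtain ⟨x, y, hne, hx, hy, hxy⟩ := exists_small_mul_eq p n
  have hdvd : (p : ℤ) ∣ x ^ 2 - x * y + y ^ 2 := by
    rw [← ZMod.intCast_zmod_eq_zero_iff_dvd]
    push_cast
    rw [hxy]
    linear_combination (y : ZMod p) ^ 2 * hn
  obtain ⟨c, hc⟩ := hdvd
  have hp0 : (0 : ℤ) < p := by exact_mod_cast hp.out.pos
  have hpos : 0 < x ^ 2 - x * y + y ^ 2 := by
    by_contra hle
    have hy0 : y = 0 := by
      have : y ^ 2 ≤ 0 := by nlinarith [sq_nonneg (2 * x - y)]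
      exact pow_eq_zero_iff (two_ne_zero) |>.1 (le_antisymm this (sq_nonneg y))
    subst hy0
    have : x = 0 := pow_eq_zero_iff (two_ne_zero) |>.1 (le_antisymm (by linarith) (sq_nonneg x))
    subst this
    exact hne rfl
  have hlt : x ^ 2 - x * y + y ^ 2 < 3 * p := by nlinarith [sq_nonneg (x + y)]
  have hc0 : 0 < c := by
    rw [hc] at hpos
    exact pos_of_mul_pos_right hpos hp0.le
  have hc3 : c < 3 := by
    rw [hc] at hlt
    nlinarith
  obtain rfl | rfl : c = 1 ∨ c = 2 := by omega
  · exact ⟨x, y, by rw [hc]; ring⟩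
  · -- a norm is never twice an odd number, because `2` is inert
    have : Fact (Nat.Prime 2) := ⟨Nat.prime_two⟩
    obtain ⟨⟨u, rfl⟩, ⟨v, rfl⟩⟩ := dvd_of_dvd_eisenstein_norm (p := 2) rfl (x := x) (y := y)
      ⟨p, by rw [hc]; push_cast; ring⟩
    have : (p : ℤ) = 2 * (u ^ 2 - u * v + v ^ 2) := by push_cast at hc; linarith
    have h2 : 2 ∣ p := by exact_mod_cast Dvd.intro _ this.symm
    have := (Nat.prime_dvd_prime_iff_eq Nat.prime_two hp.out).1 h2
    omega

theorem primaryReps_nonempty {p : ℕ} [hp : Fact p.Prime] (h1 : p % 3 = 1) :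
    (primaryReps p).Nonempty := by
  obtain ⟨a, b, hab⟩ := exists_eisenstein_norm_eq h1
  -- one of the associates `z`, `ω z`, `ω² z` has `ω`-coordinate divisible by `3`
  obtain ⟨x, y, hxy, hy⟩ : ∃ x y : ℤ, x ^ 2 - x * y + y ^ 2 = p ∧ 3 ∣ y := by
    by_cases hb : 3 ∣ b
    · exact ⟨a, b, hab, hb⟩
    by_cases ha : 3 ∣ a
    · exact ⟨b - a, -a, by rw [← hab]; ring, by omega⟩
    by_cases hc : 3 ∣ a - b
    · exact ⟨-b, a - b, by rw [← hab]; ring, hc⟩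
    exfalso
    obtain ⟨t, ht⟩ : 3 ∣ a + b := by
      have ha' : a % 3 = 1 ∨ a % 3 = 2 := by omega
      have hb' : b % 3 = 1 ∨ b % 3 = 2 := by omega
      rcases ha' with ha' | ha' <;> rcases hb' with hb' | hb' <;> omega
    obtain rfl : b = 3 * t - a := by omega
    have : (p : ℤ) = 3 * (3 * t ^ 2 - 3 * t * a + a ^ 2) := by rw [← hab]; ring
    omega
  -- one of `± (x + y ω)` is then primary
  have hx : ¬ 3 ∣ x := by
    rintro ⟨u, rfl⟩
    obtain ⟨v, rfl⟩ := hy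
    have : (p : ℤ) = 3 * (3 * u ^ 2 - 3 * u * v + 3 * v ^ 2) := by rw [← hxy]; ring
    omega
  by_cases h : 3 ∣ x - 1
  · exact ⟨(x, y), hxy, h, hy⟩
  · exact ⟨(-x, -y), by simp only; rw [← hxy]; ring, by simp only; omega, by simp only; omega⟩

/-- For an inert prime `p`, every element of norm divisible by `p` is divisible by `p`; the factor
`-p` is the primary associate of `p`. -/
theorem ncard_primaryReps_inert {p : ℕ} [hp : Fact p.Prime] (h2 : p % 3 = 2) (M : ℤ) :
    (primaryReps (p * M)).ncard = if (p : ℤ) ∣ M then (primaryReps (M / p)).ncard else 0 := by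
  have hp0 : (p : ℤ) ≠ 0 := by exact_mod_cast hp.out.ne_zero
  split_ifs with h
  · obtain ⟨M, rfl⟩ := h
    rw [Int.mul_ediv_cancel_left _ hp0]
    symm
    have hinj : Function.Injective fun z : ℤ × ℤ => (-(p : ℤ) * z.1, -(p : ℤ) * z.2) := by
      rintro ⟨x, y⟩ ⟨u, v⟩ h
      simpa [hp.out.ne_zero] using h
    rw [← Set.ncard_image_of_injective _ hinj]
    congr 1
    ext ⟨x, y⟩
    simp only [primaryReps, Set.mem_image, Set.mem_ofPred_eq, Prod.exists, Prod.mk.injEq]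
    constructor
    · rintro ⟨u, v, ⟨h, ⟨a, ha⟩, ⟨b, rfl⟩⟩, rfl, rfl⟩
      obtain rfl : u = 3 * a + 1 := by omega
      refine ⟨by rw [← h]; ring, ?_, Dvd.intro (-p * b) (by ring)⟩
      obtain ⟨t, ht⟩ : ∃ t, (p : ℤ) = 3 * t + 2 := ⟨p / 3, by omega⟩
      exact ⟨-p * a - t - 1, by rw [ht]; ring⟩
    · rintro ⟨h, hx, hy⟩
      obtain ⟨⟨u, rfl⟩, ⟨v, rfl⟩⟩ := dvd_of_dvd_eisenstein_norm h2 (x := x) (y := y) ⟨_, h⟩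
      refine ⟨-u, -v, ⟨?_, ?_, ?_⟩, by ring, by ring⟩
      · have : (p : ℤ) * p * ((-u) ^ 2 - -u * -v + (-v) ^ 2) = p * p * M := by linarith
        exact mul_left_cancel₀ (mul_ne_zero hp0 hp0) this
      · obtain ⟨t, ht⟩ : ∃ t, (p : ℤ) = 3 * t + 2 := ⟨p / 3, by omega⟩
        have : (p : ℤ) * u - 1 = 3 * (t * u) + 2 * u - 1 := by rw [ht]; ring
        omega
      · obtain ⟨t, ht⟩ : ∃ t, (p : ℤ) = 3 * t + 2 := ⟨p / 3, by omega⟩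
        have : (p : ℤ) * v = 3 * (t * v) + 2 * v := by rw [ht]; ring
        omega
  · rw [Set.ncard_eq_zero (finite_primaryReps _), Set.eq_empty_iff_forall_notMem]
    rintro ⟨x, y⟩ ⟨hn, -, -⟩
    obtain ⟨⟨u, rfl⟩, ⟨v, rfl⟩⟩ := dvd_of_dvd_eisenstein_norm h2 (x := x) (y := y) ⟨_, hn⟩
    apply h
    refine ⟨u ^ 2 - u * v + v ^ 2, mul_left_cancel₀ hp0 ?_⟩
    rw [← hn]; ring

/-- For a split prime `p = π π̄`, an element of norm divisible by `p` is divisible by `π` or by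
`π̄`, and by both only if it is divisible by `p`. -/
theorem ncard_primaryReps_split {p : ℕ} [hp : Fact p.Prime] (h1 : p % 3 = 1) (M : ℤ) :
    (primaryReps (p * M)).ncard + (if (p : ℤ) ∣ M then (primaryReps (M / p)).ncard else 0) =
      2 * (primaryReps M).ncard := by
  have hp0 : (p : ℤ) ≠ 0 := by exact_mod_cast hp.out.ne_zero
  have hpp : Prime (p : ℤ) := Nat.prime_iff_prime_int.1 hp.out
  obtain ⟨⟨a, b⟩, hab, ha, hb⟩ := primaryReps_nonempty h1
  simp only at hab ha hb
  obtain ⟨a', rfl⟩ : ∃ a', a = 3 * a' + 1 := ⟨a / 3, by omega⟩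
  obtain ⟨b', rfl⟩ := hb
  set a := 3 * a' + 1 with ha'
  set b := 3 * b' with hb'
  have hpb : ¬ (p : ℤ) ∣ b := by
    intro h
    have h2 : (p : ℤ) ∣ a := by
      apply hpp.dvd_of_dvd_pow (n := 2)
      have : a ^ 2 = p + b * (a - b) := by linarith
      rw [this]
      exact dvd_add dvd_rfl (h.mul_right _)
    obtain ⟨u, hu⟩ := h
    obtain ⟨v, hv⟩ := h2
    rw [hu, hv] at hab
    have : (p : ℤ) * (v ^ 2 - v * u + u ^ 2) = 1 := by
      apply mul_left_cancel₀ hp0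
      linarith
    exact hpp.not_dvd_one (Dvd.intro _ this)
  -- multiplication by `π = a + b ω` and by its conjugate
  set f : ℤ × ℤ → ℤ × ℤ := fun z => (z.1 * a - z.2 * b, z.1 * b + z.2 * a - z.2 * b) with hf
  set g : ℤ × ℤ → ℤ × ℤ := fun z => (z.1 * a - z.1 * b + z.2 * b, z.2 * a - z.1 * b) with hg
  have hgf : ∀ z, g (f z) = (p * z.1, p * z.2) := by
    rintro ⟨x, y⟩
    simp only [hf, hg, ← hab]
    ext <;> simp only <;> ring
  have hfg : ∀ z, f (g z) = (p * z.1, p * z.2) := by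
    rintro ⟨x, y⟩
    simp only [hf, hg, ← hab]
    ext <;> simp only <;> ring
  have hscale : Function.Injective fun z : ℤ × ℤ => ((p : ℤ) * z.1, (p : ℤ) * z.2) := by
    rintro ⟨x, y⟩ ⟨u, v⟩ h
    simpa [hp.out.ne_zero] using h
  have hfi : Function.Injective f := by
    refine Function.Injective.of_comp (f := g) ?_
    rwa [show g ∘ f = _ from funext hgf]
  have hgi : Function.Injective g := by
    refine Function.Injective.of_comp (f := f) ?_
    rwa [show f ∘ g = _ from funext hfg]
  -- each of the two multiplications preserves and reflects being primary of the right norm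
  have hfm : ∀ z N, f z ∈ primaryReps (p * N) ↔ z ∈ primaryReps N := by
    rintro ⟨x, y⟩ N
    simp only [primaryReps, Set.mem_ofPred_eq, hf]
    refine and_congr ?_ ?_
    · rw [← mul_right_inj' hp0 (b := x ^ 2 - x * y + y ^ 2), ← hab]
      ring_nf
    · have e1 : x * a - y * b - 1 = 3 * (a' * x - y * b') + (x - 1) := by rw [ha', hb']; ring
      have e2 : x * b + y * a - y * b = 3 * (x * b' + a' * y - y * b') + y := by
        rw [ha', hb']; ring
      rw [e1, e2]
      omega
  have hgm : ∀ z N, g z ∈ primaryReps (p * N) ↔ z ∈ primaryReps N := by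
    rintro ⟨x, y⟩ N
    simp only [primaryReps, Set.mem_ofPred_eq, hg]
    refine and_congr ?_ ?_
    · rw [← mul_right_inj' hp0 (b := x ^ 2 - x * y + y ^ 2), ← hab]
      ring_nf
    · have e1 : x * a - x * b + y * b - 1 = 3 * (a' * x - x * b' + y * b') + (x - 1) := by
        rw [ha', hb']; ring
      have e2 : y * a - x * b = 3 * (y * a' - x * b') + y := by rw [ha', hb']; ring
      rw [e1, e2]
      omega
  have hunion : primaryReps (p * M) = f '' primaryReps M ∪ g '' primaryReps M := by
    ext ⟨x, y⟩
    constructor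
    · intro hz
      have hn : x ^ 2 - x * y + y ^ 2 = p * M := hz.1
      -- the `ω`-coordinates of `z π̄` and `z π` have product divisible by `p`
      have hprod : (p : ℤ) ∣ (g (x, y)).2 * (f (x, y)).2 := by
        refine ⟨y ^ 2 - b ^ 2 * M, ?_⟩
        simp only [hf, hg]
        linear_combination y ^ 2 * hab - b ^ 2 * hn
      -- then the other coordinate is divisible by `p` too, since `p` divides the norm
      have key : ∀ u v : ℤ, (p : ℤ) ∣ u ^ 2 - u * v + v ^ 2 → (p : ℤ) ∣ v → (p : ℤ) ∣ u := by
        intro u v h hv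
        apply hpp.dvd_of_dvd_pow (n := 2)
        have : u ^ 2 = (u ^ 2 - u * v + v ^ 2) + v * (u - v) := by ring
        rw [this]
        exact dvd_add h (hv.mul_right _)
      rcases hpp.dvd_or_dvd hprod with h | h
      · left
        have hn2 : (g (x, y)).1 ^ 2 - (g (x, y)).1 * (g (x, y)).2 + (g (x, y)).2 ^ 2
            = p * (p * M) := ((hgm _ _).2 hz).1
        obtain ⟨u, hu⟩ := key _ _ (by rw [hn2]; exact Dvd.intro _ rfl) h
        obtain ⟨v, hv⟩ := h
        have hzz : f (u, v) = (x, y) := by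
          apply hgi
          rw [hgf]
          exact Prod.ext hu.symm hv.symm
        refine ⟨(u, v), ?_, hzz⟩
        rw [← hfm, hzz]
        exact hz
      · right
        have hn2 : (f (x, y)).1 ^ 2 - (f (x, y)).1 * (f (x, y)).2 + (f (x, y)).2 ^ 2
            = p * (p * M) := ((hfm _ _).2 hz).1
        obtain ⟨u, hu⟩ := key _ _ (by rw [hn2]; exact Dvd.intro _ rfl) h
        obtain ⟨v, hv⟩ := h
        have hzz : g (u, v) = (x, y) := by
          apply hfi
          rw [hfg]
          exact Prod.ext hu.symm hv.symm
        refine ⟨(u, v), ?_, hzz⟩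
        rw [← hgm, hzz]
        exact hz
    · rintro (⟨z, hz, hzz⟩ | ⟨z, hz, hzz⟩)
      · rw [← hzz]; exact (hfm _ _).2 hz
      · rw [← hzz]; exact (hgm _ _).2 hz
  have hinter : ∀ z ∈ f '' primaryReps M ∩ g '' primaryReps M,
      ∃ w : ℤ × ℤ, ((p : ℤ) * w.1, (p : ℤ) * w.2) = z := by
    rintro ⟨x, y⟩ ⟨⟨w, -, hw⟩, ⟨w', -, hw'⟩⟩
    have e1 := hgf w
    have e2 := hfg w'
    rw [hw] at e1
    rw [hw'] at e2
    simp only [hf, hg, Prod.mk.injEq] at e1 e2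
    have h3 : ¬ (p : ℤ) ∣ 3 := by
      intro h
      have h' : p ∣ 3 := by exact_mod_cast h
      have := (Nat.prime_dvd_prime_iff_eq hp.out Nat.prime_three).1 h'
      omega
    have hy : (p : ℤ) ∣ y := by
      have : (p : ℤ) ∣ b * (3 * y) :=
        ⟨w'.2 - w.2 + 2 * (w.1 - w'.1), by linear_combination e2.2 - e1.2 + 2 * e1.1 - 2 * e2.1⟩
      exact (hpp.dvd_or_dvd ((hpp.dvd_or_dvd this).resolve_left hpb)).resolve_left h3
    have hx : (p : ℤ) ∣ x := by
      have : (p : ℤ) ∣ b * (3 * x) :=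
        ⟨2 * (w'.2 - w.2) + (w.1 - w'.1), by linear_combination 2 * e2.2 - 2 * e1.2 + e1.1 - e2.1⟩
      exact (hpp.dvd_or_dvd ((hpp.dvd_or_dvd this).resolve_left hpb)).resolve_left h3
    obtain ⟨u, rfl⟩ := hx
    obtain ⟨v, rfl⟩ := hy
    exact ⟨(u, v), rfl⟩
  have hcard : (f '' primaryReps M ∩ g '' primaryReps M).ncard =
      if (p : ℤ) ∣ M then (primaryReps (M / p)).ncard else 0 := by
    split_ifs with h
    · obtain ⟨K, rfl⟩ := h
      rw [Int.mul_ediv_cancel_left _ hp0, ← Set.ncard_image_of_injective (primaryReps K) hscale]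
      congr 1
      ext z
      constructor
      · intro hz
        obtain ⟨w, rfl⟩ := hinter z hz
        obtain ⟨⟨v, hv, hvz⟩, -⟩ := hz
        refine ⟨w, ?_, rfl⟩
        rw [← hfg] at hvz
        rw [← hgm, ← hfi hvz]
        exact hv
      · rintro ⟨w, hw, rfl⟩
        exact ⟨⟨g w, (hgm _ _).2 hw, hfg w⟩, ⟨f w, (hfm _ _).2 hw, hgf w⟩⟩
    · rw [Set.ncard_eq_zero (((finite_primaryReps M).image f).inter_of_left _),
        Set.eq_empty_iff_forall_notMem]
      intro z hz
      obtain ⟨w, rfl⟩ := hinter z hz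
      obtain ⟨⟨v, hv, hvz⟩, -⟩ := hz
      rw [← hfg] at hvz
      obtain rfl := hfi hvz
      have hN := hv.1
      apply h
      refine ⟨w.1 ^ 2 - w.1 * w.2 + w.2 ^ 2, ?_⟩
      rw [← hN, ← hab]
      simp only [hg]
      ring
  rw [← hcard, hunion, Set.ncard_union_add_ncard_inter _ _ ((finite_primaryReps M).image f)
    ((finite_primaryReps M).image g), Set.ncard_image_of_injective _ hfi,
    Set.ncard_image_of_injective _ hgi]
  ring

/-! ### Divisor sums of the character modulo three -/

/-- The divisors of `p * M` are the divisors of `M` together with `p` times these, and the two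
families overlap in `p` times the divisors of `M / p`. -/
theorem sum_divisors_prime_mul {p M : ℕ} (hp : p.Prime) (hM : M ≠ 0) (χ : ℕ → ℤ)
    (hχ : ∀ a b, χ (a * b) = χ a * χ b) :
    ∑ d ∈ (p * M).divisors, χ d + χ p * (if p ∣ M then ∑ d ∈ (M / p).divisors, χ d else 0) =
      (1 + χ p) * ∑ d ∈ M.divisors, χ d := by
  have hinj : Function.Injective fun d : ℕ => p * d := fun a b h =>
    Nat.eq_of_mul_eq_mul_left hp.pos h
  have hsum : ∀ K : ℕ, ∑ d ∈ K.divisors.image (p * ·), χ d = χ p * ∑ d ∈ K.divisors, χ d := by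
    intro K
    rw [Finset.sum_image hinj.injOn, Finset.mul_sum]
    simp [hχ]
  have hunion : (p * M).divisors = M.divisors ∪ M.divisors.image (p * ·) := by
    ext d
    simp only [Nat.mem_divisors, Finset.mem_union, Finset.mem_image]
    constructor
    · rintro ⟨h, -⟩
      by_cases hpd : p ∣ d
      · obtain ⟨e, rfl⟩ := hpd
        exact Or.inr ⟨e, ⟨Nat.dvd_of_mul_dvd_mul_left hp.pos h, hM⟩, rfl⟩
      · exact Or.inl ⟨((hp.coprime_iff_not_dvd.2 hpd).symm.dvd_of_dvd_mul_left h), hM⟩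
    · rintro (⟨h, -⟩ | ⟨e, ⟨h, -⟩, rfl⟩)
      · exact ⟨h.mul_left _, mul_ne_zero hp.ne_zero hM⟩
      · exact ⟨Nat.mul_dvd_mul_left _ h, mul_ne_zero hp.ne_zero hM⟩
  have hinter : ∑ d ∈ M.divisors ∩ M.divisors.image (p * ·), χ d =
      χ p * (if p ∣ M then ∑ d ∈ (M / p).divisors, χ d else 0) := by
    split_ifs with h
    · obtain ⟨K, rfl⟩ := h
      have hK : K ≠ 0 := right_ne_zero_of_mul hM
      rw [Nat.mul_div_cancel_left _ hp.pos, ← hsum]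
      congr 1
      ext d
      simp only [Finset.mem_inter, Finset.mem_image, Nat.mem_divisors]
      constructor
      · rintro ⟨⟨h, -⟩, e, -, rfl⟩
        exact ⟨e, ⟨Nat.dvd_of_mul_dvd_mul_left hp.pos h, hK⟩, rfl⟩
      · rintro ⟨e, ⟨h, -⟩, rfl⟩
        exact ⟨⟨Nat.mul_dvd_mul_left _ h, hM⟩, e, ⟨h.mul_left _, hM⟩, rfl⟩
    · rw [mul_zero]
      apply Finset.sum_eq_zero
      intro d hd
      simp only [Finset.mem_inter, Finset.mem_image, Nat.mem_divisors] at hd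
      obtain ⟨⟨hd, -⟩, e, -, rfl⟩ := hd
      exact absurd ((Nat.dvd_mul_right p e).trans hd) h
  rw [hunion, ← hinter, Finset.sum_union_inter, hsum]
  ring

theorem jacobiSym_three_of_mod_eq_one {d : ℕ} (h : d % 3 = 1) : jacobiSym (d : ℤ) 3 = 1 := by
  rw [jacobiSym.mod_left, show (d : ℤ) % (3 : ℕ) = 1 by omega, jacobiSym.one_left]

theorem jacobiSym_three_of_mod_eq_two {d : ℕ} (h : d % 3 = 2) : jacobiSym (d : ℤ) 3 = -1 := by
  rw [jacobiSym.mod_left, show (d : ℤ) % (3 : ℕ) = 2 by omega]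
  norm_num

/-- The primary Eisenstein integers of norm `N` are counted by `∑_{d ∣ N} (d / 3)`. The proof is by
strong induction: both sides satisfy the same recursion when a prime is split off `N`. -/
theorem ncard_primaryReps_eq_sum_jacobiSym (N : ℕ) (hN : ¬ 3 ∣ N) :
    ((primaryReps N).ncard : ℤ) = ∑ d ∈ N.divisors, jacobiSym (d : ℤ) 3 := by
  induction N using Nat.strong_induction_on with
  | _ N ih =>
  by_cases h1 : N = 1
  · subst h1
    simp [primaryReps_one]
  have hp := Nat.minFac_prime h1
  have hN0 : N ≠ 0 := by rintro rfl; simp at hN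
  obtain ⟨M, hM⟩ := Nat.minFac_dvd N
  set p := N.minFac
  have : Fact p.Prime := ⟨hp⟩
  rw [hM] at hN0 hN ih ⊢
  clear_value p
  have hM0 : M ≠ 0 := right_ne_zero_of_mul hN0
  have hlt : M < p * M := by
    have := hp.two_le
    have : 0 < M := Nat.pos_of_ne_zero hM0
    nlinarith
  have ihM := ih M hlt fun h => hN (h.mul_left _)
  have ihK : ((if (p : ℤ) ∣ M then (primaryReps (M / p)).ncard else 0 : ℕ) : ℤ) =
      if p ∣ M then ∑ d ∈ (M / p).divisors, jacobiSym (d : ℤ) 3 else 0 := by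
    simp only [Int.natCast_dvd_natCast]
    split_ifs with h
    · rw [← ih (M / p) ((Nat.div_le_self _ _).trans_lt hlt)
        fun h' => hN ((h'.trans (Nat.div_dvd_of_dvd h)).mul_left _)]
      norm_cast
    · simp
  have hsum := sum_divisors_prime_mul hp hM0 (fun d => jacobiSym (d : ℤ) 3)
    fun a b => by push_cast; exact jacobiSym.mul_left _ _ _
  have h3 : p % 3 = 1 ∨ p % 3 = 2 := by
    have : ¬ 3 ∣ p := fun h => hN (h.mul_right _)
    omega
  push_cast
  rcases h3 with h3 | h3
  · have hr := ncard_primaryReps_split h3 M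
    rw [jacobiSym_three_of_mod_eq_one h3] at hsum
    zify at hr
    rw [← ihM] at hsum
    push_cast at ihK
    rw [ihK] at hr
    linarith
  · have hr := ncard_primaryReps_inert h3 M
    rw [jacobiSym_three_of_mod_eq_two h3] at hsum
    rw [hr, ihK]
    linarith

/-! ### Powers modulo powers of three -/

theorem pow_modEq_jacobiSym {ℓ s d : ℕ} (hodd : Odd ℓ) (hdvd : 3 ^ s ∣ ℓ) (hd : ¬ 3 ∣ d) :
    (d : ℤ) ^ ℓ ≡ jacobiSym (d : ℤ) 3 [ZMOD 3 ^ (s + 1)] := by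
  obtain ⟨ε, hε, hdε, hεodd⟩ : ∃ ε : ℤ, jacobiSym (d : ℤ) 3 = ε ∧ ((3 : ℕ) : ℤ) ∣ ε - d ∧
      ε ^ ℓ = ε := by
    rcases (by omega : d % 3 = 1 ∨ d % 3 = 2) with h | h
    · exact ⟨1, jacobiSym_three_of_mod_eq_one h, by push_cast; omega, one_pow _⟩
    · exact ⟨-1, jacobiSym_three_of_mod_eq_two h, by push_cast; omega, hodd.neg_one_pow⟩
  rw [hε, ← hεodd]
  obtain ⟨m, rfl⟩ := hdvd
  rw [pow_mul, pow_mul]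
  apply Int.ModEq.pow
  rw [Int.modEq_iff_dvd]
  exact_mod_cast dvd_sub_pow_of_dvd_sub hdε s

theorem jacobiSym_mul_pow_modEq {ℓ s d : ℕ} (hodd : Odd ℓ) (hdvd : 3 ^ s ∣ ℓ) (hd : ¬ 3 ∣ d) :
    jacobiSym (d : ℤ) 3 * (d : ℤ) ^ (2 * ℓ) ≡ jacobiSym (d : ℤ) 3 [ZMOD 3 ^ (s + 1)] := by
  have h := (pow_modEq_jacobiSym hodd hdvd hd).pow 2
  rw [← pow_mul, mul_comm ℓ 2] at h
  have h1 : jacobiSym (d : ℤ) 3 ^ 2 = 1 := by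
    rcases (by omega : d % 3 = 1 ∨ d % 3 = 2) with h | h
    · rw [jacobiSym_three_of_mod_eq_one h]; rfl
    · rw [jacobiSym_three_of_mod_eq_two h]; rfl
  rw [h1] at h
  simpa using h.mul_left (jacobiSym (d : ℤ) 3)

/-! ### Partitions as Young diagrams -/

theorem YoungDiagram.rowLen_eq_zero_of_card_le {μ : YoungDiagram} {M : ℕ} (h : μ.card ≤ M) :
    μ.rowLen M = 0 := by
  by_contra h0
  have h1 : (M, 0) ∈ μ := YoungDiagram.mem_iff_lt_rowLen.2 (Nat.pos_of_ne_zero h0)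
  have h2 := YoungDiagram.mem_iff_lt_colLen.1 h1
  rw [YoungDiagram.colLen_eq_card] at h2
  have h3 : (μ.col 0).card ≤ μ.card := Finset.card_le_card (Finset.filter_subset _ _)
  omega

theorem YoungDiagram.sum_rowLen_eq_card {μ : YoungDiagram} {M : ℕ} (h : μ.rowLen M = 0) :
    ∑ i ∈ Finset.range M, μ.rowLen i = μ.card := by
  rw [YoungDiagram.card, Finset.card_eq_sum_card_fiberwise (f := Prod.fst) (t := Finset.range M)]
  · exact Finset.sum_congr rfl fun i _ => YoungDiagram.rowLen_eq_card μ
  · rintro ⟨i, j⟩ hc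
    have h1 : j < μ.rowLen i := YoungDiagram.mem_iff_lt_rowLen.1 hc
    simp only [Finset.coe_range, Set.mem_Iio]
    by_contra hi
    have := μ.rowLen_anti M i (by omega)
    omega

theorem YoungDiagram.sum_rowLens (μ : YoungDiagram) : μ.rowLens.sum = μ.card := by
  have h : μ.rowLen (μ.colLen 0) = 0 := by
    by_contra h0
    exact lt_irrefl _ (YoungDiagram.mem_iff_lt_colLen.1
      (YoungDiagram.mem_iff_lt_rowLen.2 (Nat.pos_of_ne_zero h0)))
  rw [← YoungDiagram.sum_rowLen_eq_card h]
  rfl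

theorem Nat.Partition.rowLens_ferrersGraph {n : ℕ} (p : n.Partition) :
    p.ferrersGraph.rowLens = p.parts.sort (· ≥ ·) :=
  YoungDiagram.rowLens_ofRowLens_eq_self fun x hx => p.parts_pos (by simpa using hx)

theorem Nat.Partition.card_ferrersGraph {n : ℕ} (p : n.Partition) : p.ferrersGraph.card = n := by
  rw [← YoungDiagram.sum_rowLens, p.rowLens_ferrersGraph, ← Multiset.sum_coe, Multiset.sort_eq,
    p.parts_sum]

theorem Nat.Partition.ferrersGraph_injective {n : ℕ} :
    Function.Injective (Nat.Partition.ferrersGraph (n := n)) := by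
  intro p q h
  have h1 := congrArg YoungDiagram.rowLens h
  rw [p.rowLens_ferrersGraph, q.rowLens_ferrersGraph] at h1
  ext1
  rw [← Multiset.sort_eq p.parts (· ≥ ·), h1, Multiset.sort_eq]

theorem YoungDiagram.exists_ferrersGraph_eq (μ : YoungDiagram) :
    ∃ p : μ.card.Partition, p.ferrersGraph = μ := by
  refine ⟨⟨μ.rowLens, fun {x} hx => μ.pos_of_mem_rowLens x (by simpa using hx),
    by rw [Multiset.sum_coe, μ.sum_rowLens]⟩, ?_⟩
  apply YoungDiagram.equivListRowLens.injective
  ext1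
  simp only [YoungDiagram.equivListRowLens_apply_coe, Nat.Partition.rowLens_ferrersGraph]
  refine List.Perm.eq_of_pairwise' (r := (· ≥ ·)) (Multiset.pairwise_sort _ _)
    μ.rowLens_sorted.pairwise ?_
  rw [← Multiset.coe_eq_coe, Multiset.sort_eq]

theorem coreCount_eq_card_youngDiagram (t n : ℕ) :
    coreCount t n =
      Nat.card {μ : YoungDiagram // μ.card = n ∧ ∀ c ∈ μ.cells, ¬ t ∣ μ.hookNumber c} := by
  refine Nat.card_congr (Equiv.ofBijective
    (fun p => ⟨p.1.ferrersGraph, p.1.card_ferrersGraph, p.2⟩) ⟨?_, ?_⟩)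
  · intro p q h
    exact Subtype.ext (Nat.Partition.ferrersGraph_injective (congrArg Subtype.val h))
  · rintro ⟨μ, rfl, hμ⟩
    obtain ⟨p, hp⟩ := μ.exists_ferrersGraph_eq
    exact ⟨⟨p, by unfold Nat.Partition.IsCore; rwa [hp]⟩, Subtype.ext hp⟩

/-! ### Beta-sets and cores -/

/-- The beta-set of `μ` with `M` beads: row `i < M` contributes the bead `μ.rowLen i + (M - 1 - i)`.
The rows are indexed from the bottom, by `j = M - 1 - i`, so that the beads come in increasing order.
It determines `μ` when `μ` has at most `M` rows, that is, when `μ.rowLen M = 0`. -/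
def YoungDiagram.betaSet (μ : YoungDiagram) (M : ℕ) : Finset ℕ :=
  (Finset.range M).image fun j => μ.rowLen (M - 1 - j) + j

theorem YoungDiagram.strictMono_beta (μ : YoungDiagram) (M : ℕ) :
    StrictMono fun j => μ.rowLen (M - 1 - j) + j := by
  intro i j hij
  have := μ.rowLen_anti (M - 1 - j) (M - 1 - i) (by omega)
  simp only
  omega

theorem YoungDiagram.card_betaSet (μ : YoungDiagram) (M : ℕ) : (μ.betaSet M).card = M := by
  rw [YoungDiagram.betaSet, Finset.card_image_of_injective _ (μ.strictMono_beta M).injective,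
    Finset.card_range]

theorem YoungDiagram.sum_betaSet {μ : YoungDiagram} {M : ℕ} (h : μ.rowLen M = 0) :
    ∑ b ∈ μ.betaSet M, b = μ.card + ∑ j ∈ Finset.range M, j := by
  rw [YoungDiagram.betaSet, Finset.sum_image (μ.strictMono_beta M).injective.injOn,
    Finset.sum_add_distrib, Finset.sum_range_reflect, YoungDiagram.sum_rowLen_eq_card h]

theorem YoungDiagram.mem_betaSet {μ : YoungDiagram} {M b : ℕ} :
    b ∈ μ.betaSet M ↔ ∃ i < M, μ.rowLen i + (M - 1 - i) = b := by
  simp only [YoungDiagram.betaSet, Finset.mem_image, Finset.mem_range]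
  constructor
  · rintro ⟨j, hj, rfl⟩
    exact ⟨M - 1 - j, by omega, by rw [Nat.sub_sub_self (by omega)]⟩
  · rintro ⟨i, hi, rfl⟩
    exact ⟨M - 1 - i, by omega, by rw [Nat.sub_sub_self (by omega)]⟩

theorem YoungDiagram.eq_of_betaSet_eq {μ ν : YoungDiagram} {M : ℕ} (hμ : μ.rowLen M = 0)
    (hν : ν.rowLen M = 0) (h : μ.betaSet M = ν.betaSet M) : μ = ν := by
  have key : (fun j : Fin M => μ.rowLen (M - 1 - j) + j) =
      fun j : Fin M => ν.rowLen (M - 1 - j) + j := by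
    have hs : ∀ ρ : YoungDiagram, StrictMono fun j : Fin M => ρ.rowLen (M - 1 - j) + j :=
      fun ρ i j hij => ρ.strictMono_beta M hij
    refine ((hs μ).range_inj (hs ν)).1 ?_
    have hr : ∀ ρ : YoungDiagram, Set.range (fun j : Fin M => ρ.rowLen (M - 1 - j) + j) =
        ρ.betaSet M := by
      intro ρ
      ext b
      simp [YoungDiagram.betaSet, Fin.exists_iff]
    rw [hr, hr, h]
  ext ⟨i, j⟩
  rw [YoungDiagram.mem_cells, YoungDiagram.mem_cells, YoungDiagram.mem_iff_lt_rowLen,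
    YoungDiagram.mem_iff_lt_rowLen]
  by_cases hi : i < M
  · have := congrFun key ⟨M - 1 - i, by omega⟩
    simp only [Nat.sub_sub_self (show i ≤ M - 1 by omega)] at this
    omega
  · have := μ.rowLen_anti M i (by omega)
    have := ν.rowLen_anti M i (by omega)
    omega

/-- Every finite set of natural numbers is a beta-set: its `j`-th smallest element `e j` is at least
`j`, and the differences `e j - j` are the row lengths, from bottom to top. -/
theorem YoungDiagram.exists_betaSet_eq (S : Finset ℕ) :
    ∃ μ : YoungDiagram, μ.rowLen S.card = 0 ∧ μ.betaSet S.card = S := by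
  set M := S.card with hM
  set e := S.orderEmbOfFin hM.symm
  have hmono : ∀ i j : Fin M, i ≤ j → e i + (j - i : ℕ) ≤ e j := by
    intro i j hij
    obtain ⟨d, hd⟩ := Nat.exists_eq_add_of_le (show (i : ℕ) ≤ j from hij)
    induction d generalizing j with
    | zero =>
      obtain rfl : i = j := Fin.ext (by simpa using hd.symm)
      simp
    | succ d ih =>
      have hlt : (i : ℕ) + d < M := by have := j.2; omega
      have h1 := ih ⟨i + d, hlt⟩ (Fin.mk_le_mk.2 (by simp)) rfl
      have h2 : e ⟨i + d, hlt⟩ < e j := e.strictMono (Fin.lt_def.2 (by simp only; omega))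
      simp only at h1
      omega
  have hge : ∀ i : Fin M, (i : ℕ) ≤ e i := by
    intro i
    have h := hmono ⟨0, i.pos⟩ i (Fin.le_def.2 (by simp))
    simp only at h
    omega
  set w : List ℕ := List.ofFn fun i : Fin M => e i.rev - i.rev
  have hw : w.SortedGE := by
    rw [List.sortedGE_ofFn_iff]
    intro i j hij
    have h := hmono j.rev i.rev (Fin.rev_le_rev.2 hij)
    have := hge i.rev
    have := hge j.rev
    have : (j.rev : ℕ) ≤ i.rev := Fin.rev_le_rev.2 hij
    simp only
    omega
  have hlen : w.length = M := List.length_ofFn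
  refine ⟨YoungDiagram.ofRowLens w hw, ?_, ?_⟩
  · by_contra h0
    have h1 := YoungDiagram.mem_iff_lt_rowLen.2 (Nat.pos_of_ne_zero h0)
    obtain ⟨h2, -⟩ := YoungDiagram.mem_ofRowLens.1 h1
    simp only at h2
    omega
  · have hrow : ∀ i : Fin M, (YoungDiagram.ofRowLens w hw).rowLen i = e i.rev - i.rev := by
      intro i
      have := YoungDiagram.rowLen_ofRowLens (hw := hw) ⟨i, by rw [hlen]; exact i.2⟩
      simpa [w] using this
    refine Finset.eq_of_subset_of_card_le ?_ (by rw [YoungDiagram.card_betaSet])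
    intro b hb
    obtain ⟨i, hi, rfl⟩ := YoungDiagram.mem_betaSet.1 hb
    have h1 := hrow ⟨i, hi⟩
    have h2 := hge (Fin.rev ⟨i, hi⟩)
    have h3 : e (Fin.rev ⟨i, hi⟩) ∈ S := S.orderEmbOfFin_mem hM.symm _
    simp only [Fin.val_rev] at h1 h2
    rw [h1]
    convert h3 using 1
    omega

/-- The hook numbers in row `i` are the differences `b - x`, where `b` is the bead of row `i` and `x`
runs over the gaps below `b`. Hence `μ` is a `t`-core if and only if moving a bead down by `t`
never reaches a gap. -/
theorem YoungDiagram.forall_not_dvd_hookNumber_iff {μ : YoungDiagram} {M t : ℕ} (ht : 0 < t)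
    (hM : μ.rowLen M = 0) :
    (∀ c ∈ μ.cells, ¬ t ∣ μ.hookNumber c) ↔ ∀ b ∈ μ.betaSet M, t ≤ b → b - t ∈ μ.betaSet M := by
  constructor
  · intro h b hb htb
    by_contra hbt
    obtain ⟨i, hi, rfl⟩ := YoungDiagram.mem_betaSet.1 hb
    set x := μ.rowLen i + (M - 1 - i) - t with hx
    -- `m` counts the rows whose bead lies above the gap `x`
    have hex : ∃ m, M ≤ m ∨ μ.rowLen m + (M - 1 - m) ≤ x := ⟨M, Or.inl le_rfl⟩
    set m := Nat.find hex with hm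
    have hm1 := Nat.find_spec hex
    have hm2 : ∀ m' < m, m' < M ∧ x < μ.rowLen m' + (M - 1 - m') := fun m' h' => by
      have := Nat.find_min hex h'
      omega
    rw [← hm] at hm1
    have hmM : m ≤ M := Nat.find_min' hex (Or.inl le_rfl)
    have hmx : m < M → μ.rowLen m + (M - 1 - m) < x := by
      intro h'
      refine lt_of_le_of_ne (by omega) fun heq => hbt ?_
      exact YoungDiagram.mem_betaSet.2 ⟨m, h', heq⟩
    have him : i < m := by
      by_contra h'
      have hmM' : m < M := by omega
      have := hmx hmM'
      have := μ.rowLen_anti m i (by omega)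
      omega
    -- at most `x` beads lie below the gap `x`, so its column `x + m - M` involves no truncation
    have hj0 : M ≤ x + m := by
      by_cases h' : m < M
      · have := hmx h'
        omega
      · omega
    have hcol : μ.colLen (x + m - M) = m := by
      apply le_antisymm
      · by_contra h'
        have h1 := YoungDiagram.mem_iff_lt_rowLen.1
          (YoungDiagram.mem_iff_lt_colLen.2 (not_le.1 h'))
        by_cases h2 : m < M
        · have := hmx h2
          omega
        · have : m = M := by omega
          rw [this] at h1
          omega
      · by_contra h'
        have h1 := (YoungDiagram.mem_iff_lt_rowLen (μ := μ) (i := m - 1) (j := x + m - M)).not.1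
          (by rw [YoungDiagram.mem_iff_lt_colLen]; omega)
        have := hm2 (m - 1) (by omega)
        omega
    have hcell : (i, x + m - M) ∈ μ := by
      rw [YoungDiagram.mem_iff_lt_colLen, hcol]; exact him
    apply h _ hcell
    have h1 := YoungDiagram.mem_iff_lt_rowLen.1 hcell
    have : μ.hookNumber (i, x + m - M) = t := by
      simp only [YoungDiagram.hookNumber, hcol]
      omega
    rw [this]
  · rintro h ⟨i, j⟩ hc ⟨q, hq⟩
    have hc' : (i, j) ∈ μ := hc
    have h1 := YoungDiagram.mem_iff_lt_rowLen.1 hc'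
    have h2 := YoungDiagram.mem_iff_lt_colLen.1 hc'
    have hcM : μ.colLen j ≤ M := by
      by_contra h'
      have := YoungDiagram.mem_iff_lt_rowLen.1 (YoungDiagram.mem_iff_lt_colLen.2 (not_le.1 h'))
      omega
    simp only [YoungDiagram.hookNumber] at hq
    -- the bead of row `i` and the gap attached to column `j` differ by the hook number
    have hgap : j + M - μ.colLen j ∉ μ.betaSet M := by
      intro hmem
      obtain ⟨i', hi', he⟩ := YoungDiagram.mem_betaSet.1 hmem
      by_cases h' : i' < μ.colLen j
      · have := YoungDiagram.mem_iff_lt_rowLen.1 (YoungDiagram.mem_iff_lt_colLen.2 h')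
        omega
      · have := (YoungDiagram.mem_iff_lt_rowLen (μ := μ) (i := i') (j := j)).not.1
          (by rw [YoungDiagram.mem_iff_lt_colLen]; exact h')
        omega
    have hiter : ∀ q b, b ∈ μ.betaSet M → t * q ≤ b → b - t * q ∈ μ.betaSet M := by
      intro q
      induction q with
      | zero => intro b hb _; simpa using hb
      | succ q ih =>
        intro b hb hq
        rw [Nat.mul_succ] at hq ⊢
        have := h _ (ih b hb (by omega)) (by omega)
        rwa [Nat.sub_sub] at this
    apply hgap
    have := hiter q _ (YoungDiagram.mem_betaSet.2 ⟨i, by omega, rfl⟩) (by omega)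
    convert this using 1
    omega

/-- `t`-cores of size `n` correspond to beta-sets with `M ≥ n` beads that are closed under
subtracting `t`. -/
theorem coreCount_eq_card_betaSet {t n M : ℕ} (ht : 0 < t) (hn : n ≤ M) :
    coreCount t n = Nat.card {S : Finset ℕ // S.card = M ∧
      ∑ b ∈ S, b = n + ∑ j ∈ Finset.range M, j ∧ ∀ b ∈ S, t ≤ b → b - t ∈ S} := by
  rw [coreCount_eq_card_youngDiagram]
  have h0 : ∀ μ : YoungDiagram, μ.card = n → μ.rowLen M = 0 := fun μ h =>
    YoungDiagram.rowLen_eq_zero_of_card_le (by omega)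
  refine Nat.card_congr (Equiv.ofBijective
    (fun μ => ⟨μ.1.betaSet M, μ.1.card_betaSet M, ?_, ?_⟩) ⟨?_, ?_⟩)
  · rw [YoungDiagram.sum_betaSet (h0 _ μ.2.1), μ.2.1]
  · exact (YoungDiagram.forall_not_dvd_hookNumber_iff ht (h0 _ μ.2.1)).1 μ.2.2
  · rintro ⟨μ, hμ⟩ ⟨ν, hν⟩ h
    exact Subtype.ext (YoungDiagram.eq_of_betaSet_eq (h0 _ hμ.1) (h0 _ hν.1)
      (congrArg Subtype.val h))
  · rintro ⟨S, rfl, hsum, hcl⟩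
    obtain ⟨μ, hμ0, hμ⟩ := YoungDiagram.exists_betaSet_eq S
    refine ⟨⟨μ, ?_, ?_⟩, Subtype.ext hμ⟩
    · have := YoungDiagram.sum_betaSet hμ0
      rw [hμ, hsum] at this
      omega
    · rw [YoungDiagram.forall_not_dvd_hookNumber_iff ht hμ0, hμ]
      exact hcl

/-! ### Three-cores and runner lengths -/

theorem Finset.mem_iff_lt_card_of_isLowerSet {T : Finset ℕ} (hT : IsLowerSet (T : Set ℕ)) {j : ℕ} :
    j ∈ T ↔ j < T.card := by
  have hsub : T ⊆ Finset.range T.card := by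
    intro i hi
    have : Finset.range (i + 1) ⊆ T := fun x hx =>
      hT (by simpa [Nat.lt_succ_iff] using hx) hi
    have := Finset.card_le_card this
    rw [Finset.card_range] at this
    exact Finset.mem_range.2 this
  have heq := Finset.eq_of_subset_of_card_le hsub (by rw [Finset.card_range])
  conv_lhs => rw [heq]
  exact Finset.mem_range

/-- In a set closed under subtracting `3`, the elements of each residue class form an initial segment
of that class (a runner of the abacus), so the set is determined by the lengths of the runners. -/
theorem mem_iff_div_lt_card_filter {S : Finset ℕ} (h : ∀ b ∈ S, 3 ≤ b → b - 3 ∈ S) (b : ℕ) :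
    b ∈ S ↔ b / 3 < (S.filter (· % 3 = b % 3)).card := by
  set T := (S.filter (· % 3 = b % 3)).image (· / 3) with hT
  have hmem : ∀ j, j ∈ T ↔ 3 * j + b % 3 ∈ S := by
    intro j
    simp only [hT, Finset.mem_image, Finset.mem_filter]
    constructor
    · rintro ⟨a, ⟨ha, hab⟩, rfl⟩
      rwa [← hab, Nat.div_add_mod]
    · intro hj
      exact ⟨_, ⟨hj, by omega⟩, by omega⟩
  have hcard : T.card = (S.filter (· % 3 = b % 3)).card := by
    refine Finset.card_image_of_injOn fun x hx y hy hxy => ?_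
    simp only [Finset.coe_filter, Set.mem_ofPred_eq] at hx hy
    omega
  have hlow : IsLowerSet (T : Set ℕ) := by
    have step : ∀ j d, j + d ∈ T → j ∈ T := by
      intro j d
      induction d with
      | zero => exact id
      | succ d ih =>
        intro hd
        refine ih ((hmem _).2 ?_)
        have := h _ ((hmem _).1 hd) (by omega)
        convert this using 1
        omega
    intro x y hyx hx
    obtain ⟨d, rfl⟩ := Nat.exists_eq_add_of_le hyx
    exact step y d hx
  rw [← hcard, ← Finset.mem_iff_lt_card_of_isLowerSet hlow, hmem, Nat.div_add_mod]

theorem filter_mod_three_eq_image {S : Finset ℕ} {n : ℕ → ℕ} (h : ∀ b, b ∈ S ↔ b / 3 < n (b % 3))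
    {r : ℕ} (hr : r < 3) :
    S.filter (· % 3 = r) = (Finset.range (n r)).image (3 * · + r) := by
  ext b
  simp only [Finset.mem_filter, Finset.mem_image, Finset.mem_range, h]
  constructor
  · rintro ⟨hb, rfl⟩
    exact ⟨b / 3, hb, Nat.div_add_mod b 3⟩
  · rintro ⟨j, hj, rfl⟩
    have h1 : (3 * j + r) % 3 = r := by omega
    have h2 : (3 * j + r) / 3 = j := by omega
    rw [h1, h2]
    exact ⟨hj, rfl⟩

theorem card_filter_mod_three {S : Finset ℕ} {n : ℕ → ℕ} (h : ∀ b, b ∈ S ↔ b / 3 < n (b % 3))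
    {r : ℕ} (hr : r < 3) : (S.filter (· % 3 = r)).card = n r := by
  rw [filter_mod_three_eq_image h hr,
    Finset.card_image_of_injective _ fun a b hab => by omega, Finset.card_range]

theorem sum_filter_mod_three {S : Finset ℕ} {n : ℕ → ℕ} (h : ∀ b, b ∈ S ↔ b / 3 < n (b % 3))
    {r : ℕ} (hr : r < 3) :
    2 * ((∑ b ∈ S.filter (· % 3 = r), b : ℕ) : ℤ) = 3 * n r * (n r - 1) + 2 * r * n r := by
  rw [filter_mod_three_eq_image h hr, Finset.sum_image fun a _ b _ hab => by omega]
  generalize n r = m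
  induction m with
  | zero => simp
  | succ m ih =>
    rw [Finset.sum_range_succ]
    push_cast at ih ⊢
    linarith

theorem card_of_mem_iff_div_lt {S : Finset ℕ} {n : ℕ → ℕ} (h : ∀ b, b ∈ S ↔ b / 3 < n (b % 3)) :
    S.card = n 0 + n 1 + n 2 := by
  rw [Finset.card_eq_sum_card_fiberwise (f := (· % 3)) (t := Finset.range 3)
    fun b _ => by simp [Nat.mod_lt], Finset.sum_range_succ, Finset.sum_range_succ,
    Finset.sum_range_one, card_filter_mod_three h (by norm_num),
    card_filter_mod_three h (by norm_num), card_filter_mod_three h (by norm_num)]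

theorem sum_of_mem_iff_div_lt {S : Finset ℕ} {n : ℕ → ℕ} (h : ∀ b, b ∈ S ↔ b / 3 < n (b % 3)) :
    2 * ((∑ b ∈ S, b : ℕ) : ℤ) =
      3 * (n 0 * (n 0 - 1) + n 1 * (n 1 - 1) + n 2 * (n 2 - 1)) + 2 * n 1 + 4 * n 2 := by
  rw [← Finset.sum_fiberwise_of_maps_to (g := (· % 3)) (t := Finset.range 3)
    fun b _ => by simp [Nat.mod_lt], Finset.sum_range_succ, Finset.sum_range_succ,
    Finset.sum_range_one]
  have h0 := sum_filter_mod_three h (r := 0) (by norm_num)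
  have h1 := sum_filter_mod_three h (r := 1) (by norm_num)
  have h2 := sum_filter_mod_three h (r := 2) (by norm_num)
  push_cast at h0 h1 h2 ⊢
  linarith

theorem two_mul_sum_range_id (M : ℕ) :
    2 * ((∑ j ∈ Finset.range M, j : ℕ) : ℤ) = M * (M - 1) := by
  induction M with
  | zero => simp
  | succ M ih =>
    rw [Finset.sum_range_succ]
    push_cast at ih ⊢
    linarith

/-- Closed sets with runner lengths `n₀ + n₁ + n₂ = 3k` have the bead sum of a partition of `k`
exactly when the norm is `3k + 1`. -/
theorem sum_eq_iff_norm_eq {S : Finset ℕ} {n : ℕ → ℕ} {k : ℕ}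
    (h : ∀ b, b ∈ S ↔ b / 3 < n (b % 3)) (hc : S.card = 3 * k) :
    ∑ b ∈ S, b = k + ∑ j ∈ Finset.range (3 * k), j ↔
      (1 + 3 * ((n 2 : ℤ) - k)) ^ 2 - (1 + 3 * ((n 2 : ℤ) - k)) * (3 * (k - n 1)) +
        (3 * ((k : ℤ) - n 1)) ^ 2 = 3 * k + 1 := by
  have h1 := sum_of_mem_iff_div_lt h
  have h2 := two_mul_sum_range_id (3 * k)
  have h3 : (n 0 : ℤ) = 3 * k - n 1 - n 2 := by
    have := card_of_mem_iff_div_lt h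
    omega
  rw [h3] at h1
  rw [← Nat.cast_inj (R := ℤ), ← mul_right_inj' (two_ne_zero (α := ℤ)), h1]
  push_cast at h2 ⊢
  rw [mul_add 2 (k : ℤ), h2]
  constructor <;> intro h <;> linarith

/-- The `3`-cores of size `k` correspond to the primary Eisenstein integers of norm `3k + 1`, through
the runner lengths of the beta-set with `3k` beads. -/
theorem coreCount_three_eq_ncard_primaryReps (k : ℕ) :
    coreCount 3 k = (primaryReps (3 * k + 1)).ncard := by
  rw [coreCount_eq_card_betaSet (M := 3 * k) (by norm_num) (by omega), ← Nat.card_coe_set_eq]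
  refine Nat.card_congr (Equiv.ofBijective (fun S =>
    ⟨(1 + 3 * (((S.1.filter (· % 3 = 2)).card : ℤ) - k),
      3 * ((k : ℤ) - (S.1.filter (· % 3 = 1)).card)), ?_, ?_, ?_⟩) ⟨?_, ?_⟩)
  · obtain ⟨S, hc, hs, hcl⟩ := S
    exact (sum_eq_iff_norm_eq (n := fun r => (S.filter (· % 3 = r)).card)
      (mem_iff_div_lt_card_filter hcl) hc).1 hs
  · simp
  · simp
  · rintro ⟨S, hc, hs, hcl⟩ ⟨S', hc', hs', hcl'⟩ h
    have e := mem_iff_div_lt_card_filter hcl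
    have e' := mem_iff_div_lt_card_filter hcl'
    have t := card_of_mem_iff_div_lt (n := fun r => (S.filter (· % 3 = r)).card) e
    have t' := card_of_mem_iff_div_lt (n := fun r => (S'.filter (· % 3 = r)).card) e'
    have hx := congrArg (fun z => z.1.1) h
    have hy := congrArg (fun z => z.1.2) h
    simp only at hx hy t t'
    refine Subtype.ext (Finset.ext fun b => ?_)
    simp only
    rw [e, e']
    have hb : b % 3 = 0 ∨ b % 3 = 1 ∨ b % 3 = 2 := by omega
    rcases hb with hb | hb | hb <;> rw [hb] <;> omega
  · rintro ⟨⟨x, y⟩, hn, hx, hy⟩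
    simp only at hn hx hy
    obtain ⟨u, hu⟩ := hx
    obtain ⟨v, rfl⟩ := hy
    obtain rfl : x = 1 + 3 * u := by omega
    -- the three runner lengths are `k + (v - u)`, `k - v`, `k + u`; the norm bounds each coordinate
    have b0 : 0 ≤ k + (v - u) := by
      by_contra hlt
      nlinarith [sq_nonneg (1 + 3 * u + 3 * v)]
    have b1 : 0 ≤ k - v := by
      by_contra hlt
      nlinarith [sq_nonneg (2 * (1 + 3 * u) - 3 * v)]
    have b2 : 0 ≤ k + u := by
      by_contra hlt
      nlinarith [sq_nonneg (2 * (3 * v) - (1 + 3 * u))]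
    obtain ⟨n0, h0⟩ := Int.eq_ofNat_of_zero_le b0
    obtain ⟨n1, h1⟩ := Int.eq_ofNat_of_zero_le b1
    obtain ⟨n2, h2⟩ := Int.eq_ofNat_of_zero_le b2
    set n : ℕ → ℕ := fun r => if r = 0 then n0 else if r = 1 then n1 else n2 with hndef
    set S : Finset ℕ := (Finset.range (3 * (n0 + n1 + n2))).filter fun b => b / 3 < n (b % 3)
      with hS
    have hmem : ∀ b, b ∈ S ↔ b / 3 < n (b % 3) := by
      intro b
      rw [hS, Finset.mem_filter, Finset.mem_range, and_iff_right_iff_imp]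
      intro hb
      simp only [hndef] at hb
      split_ifs at hb <;> omega
    have hc : S.card = 3 * k := by
      rw [card_of_mem_iff_div_lt hmem]
      simp only [hndef, if_true, one_ne_zero, if_false, OfNat.ofNat_ne_zero, OfNat.ofNat_ne_one]
      omega
    have e1 : (n 1 : ℤ) = k - v := by simp [hndef, h1]
    have e2 : (n 2 : ℤ) = k + u := by simp [hndef, h2]
    refine ⟨⟨S, hc, ?_, ?_⟩, ?_⟩
    · rw [sum_eq_iff_norm_eq hmem hc, e1, e2, ← hn]
      ring
    · intro b hb h3
      rw [hmem] at hb ⊢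
      rw [show (b - 3) % 3 = b % 3 by omega]
      omega
    · refine Subtype.ext (Prod.ext ?_ ?_)
      · simp only
        rw [card_filter_mod_three hmem (by norm_num), e2]
        ring
      · simp only
        rw [card_filter_mod_three hmem (by norm_num), e1]
        ring

/-! ### The congruences -/

theorem mainTheorem2 (ℓ s k : ℕ) (hodd : Odd ℓ)
    (hdvd : 3 ^ s ∣ ℓ) (hexact : ¬ 3 ^ (s + 1) ∣ ℓ) :
    (∑ d ∈ (3 * k + 2).divisors, jacobiSym (d : ℤ) 3 * (d : ℤ) ^ (2 * ℓ)
        ≡ 0 [ZMOD 3 ^ (s + 1)]) ∧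
    (∑ d ∈ (3 * k + 1).divisors, jacobiSym (d : ℤ) 3 * (d : ℤ) ^ (2 * ℓ)
        ≡ (coreCount 3 k : ℤ) [ZMOD 3 ^ (s + 1)]) ∧
    (∑ d ∈ (3 * k + 2).divisors, (d : ℤ) ^ ℓ ≡ 0 [ZMOD 3 ^ (s + 1)]) ∧
    (∑ d ∈ (3 * k + 1).divisors, (d : ℤ) ^ ℓ
        ≡ (coreCount 3 k : ℤ) [ZMOD 3 ^ (s + 1)]) := by
  have h1 : ∑ d ∈ (3 * k + 1).divisors, jacobiSym (d : ℤ) 3 = coreCount 3 k := by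
    rw [← ncard_primaryReps_eq_sum_jacobiSym _ (by omega), coreCount_three_eq_ncard_primaryReps]
    push_cast
    rfl
  have h2 : ∑ d ∈ (3 * k + 2).divisors, jacobiSym (d : ℤ) 3 = 0 := by
    rw [← ncard_primaryReps_eq_sum_jacobiSym _ (by omega), primaryReps_eq_empty (by omega)]
    simp
  have hcop : ∀ N, ¬ 3 ∣ N → ∀ d ∈ N.divisors, ¬ 3 ∣ d := fun N hN d hd h =>
    hN (h.trans (Nat.dvd_of_mem_divisors hd))
  rw [← h1, ← h2]
  refine ⟨Int.ModEq.sum fun d hd => ?_, Int.ModEq.sum fun d hd => ?_,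
    Int.ModEq.sum fun d hd => ?_, Int.ModEq.sum fun d hd => ?_⟩
  · exact jacobiSym_mul_pow_modEq hodd hdvd (hcop _ (by omega) d hd)
  · exact jacobiSym_mul_pow_modEq hodd hdvd (hcop _ (by omega) d hd)
  · exact pow_modEq_jacobiSym hodd hdvd (hcop _ (by omega) d hd)
  · exact pow_modEq_jacobiSym hodd hdvd (hcop _ (by omega) d hd)
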